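/- Let $N\ge 1$, let $\mathcal T\in\mathbb R^{I_1\times\dots\times I_N}$ be a tensor, and for $n=1,\dots,N$ let $A^{(n)}\in\mathbb R^{I_n\times r_n}$ (the current factors $A_t^{(n)}$) be fixed matrices with orthonormal columns such that $\|A^{(n)}\|_{2,\infty}\le\sqrt{\mu_n r_n/I_n}$, where $\|\cdot\|_{2,\infty}$ is the largest Euclidean norm of a row. Put $$p_*=\frac{10}{3}\Big(\log\Big(2\prod_{k=1}^N I_k\Big)+5\Big)\max_{1\le n\le N}\prod_{k\ne n}\frac{\mu_k r_k}{I_k},$$ let $p\in[4p_*,\tfrac12]$, and let $\Omega$ be a random set of index tuples $(i_1,\dots,i_N)$ that contains each index tuple independently with probability $p$. Let $\Pi_\Omega$ be the map that keeps the entries of a tensor with index in $\Omega$ and sets the other entries to $0$, let $\|\cdot\|_F$ be the Frobenius norm, and for $\mathcal X\in\mathbb R^{r_1\times\dots\times r_N}$ let $[\![\mathcal X;A^{(1)},\dots,A^{(N)}]\!]=\mathcal X\times_1A^{(1)}\cdots\times_NA^{(N)}$ be the Tucker product. Let $$\mathcal X_{\rm opt}\in\arg\min_{\mathcal X}\big\|[\![\mathcal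 X;A^{(1)},\dots,A^{(N)}]\!]-\mathcal T\big\|_F,\qquad \widetilde{\mathcal X}_{\rm opt}\in\arg\min_{\mathcal X}\big\|\Pi_\Omega\big([\![\mathcal X;A^{(1)},\dots,A^{(N)}]\!]-\mathcal T\big)\big\|_F,$$ and $$\phi=\big\|[\![\mathcal X_{\rm opt};A^{(1)},\dots,A^{(N)}]\!]-\mathcal T\big\|_F,\qquad \psi=\big\|[\![\widetilde{\mathcal X}_{\rm opt};A^{(1)},\dots,A^{(N)}]\!]-\mathcal T\big\|_F.$$ Then minimizers of both problems exist, and with probability at least $0.99$ every choice of the minimizers satisfies $$\phi\le\psi\le\frac{3}{\sqrt2}\,\phi .$$ -/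

import Mathlib

open MeasureTheory ProbabilityTheory

noncomputable section

/-- Real tensors of order `N` and size `I 0 × ⋯ × I (N-1)`. -/
abbrev RTensor {N : ℕ} (I : Fin N → ℕ) : Type := (∀ n, Fin (I n)) → ℝ

/-- The Frobenius norm of a tensor. -/
def frobNorm {N : ℕ} {I : Fin N → ℕ} (T : RTensor I) : ℝ :=
  √(∑ i, T i ^ 2)

/-- The multilinear (Tucker) product `⟦X; A 0, …, A (N-1)⟧`, i.e. `X ×₁ A 0 ⋯ ×_N A (N-1)`. -/
def tuckerProd {N : ℕ} {I r : Fin N → ℕ} (X : RTensor r)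
    (A : ∀ n, Matrix (Fin (I n)) (Fin (r n)) ℝ) : RTensor I :=
  fun i => ∑ j : (∀ n, Fin (r n)), (∏ n, A n (i n) (j n)) * X j

/-- `Π_S`: keep the entries with index in `S`, replace all other entries by zero. -/
def obsProj {N : ℕ} {I : Fin N → ℕ} (S : Set (∀ n, Fin (I n))) (T : RTensor I) : RTensor I :=
  S.indicator T

/-- The norm `‖A‖_{2,∞}`: the largest Euclidean norm of a row of `A`. -/
def twoInfNorm {m k : ℕ} (A : Matrix (Fin m) (Fin k) ℝ) : ℝ :=
  ⨆ i, √(∑ j, A i j ^ 2)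

/-- The sampling threshold
`p_* = (10/3) (log (2 ∏ₖ Iₖ) + 5) maxₙ ∏_{k ≠ n} μₖ rₖ / Iₖ` (meant for `N ≥ 1`). -/
def pStar {N : ℕ} (I r : Fin N → ℕ) (μ : Fin N → ℝ) : ℝ :=
  10 / 3 * (Real.log (2 * ∏ k, (I k : ℝ)) + 5) *
    ⨆ n, ∏ k ∈ Finset.univ.erase n, μ k * (r k : ℝ) / (I k : ℝ)

/-- The residual `‖⟦X; A⟧ - T‖_F` over all entries. -/
def fullResidual {N : ℕ} {I r : Fin N → ℕ} (A : ∀ n, Matrix (Fin (I n)) (Fin (r n)) ℝ)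
    (T : RTensor I) (X : RTensor r) : ℝ :=
  frobNorm (tuckerProd X A - T)

/-- The residual `‖Π_S (⟦X; A⟧ - T)‖_F` over the entries in `S`. -/
def obsResidual {N : ℕ} {I r : Fin N → ℕ} (S : Set (∀ n, Fin (I n)))
    (A : ∀ n, Matrix (Fin (I n)) (Fin (r n)) ℝ) (T : RTensor I) (X : RTensor r) : ℝ :=
  frobNorm (obsProj S (tuckerProd X A - T))

/-- Each index belongs to the random set `S` independently, with probability `p`. -/
structure IsBernoulliSample {Ω ι : Type*} [MeasurableSpace Ω] (P : Measure Ω) (S : Ω → Set ι)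
    (p : ℝ) : Prop where
  measurable : ∀ i, MeasurableSet {ω | i ∈ S ω}
  prob : ∀ i, P.real {ω | i ∈ S ω} = p
  indep : iIndepSet (fun i => {ω | i ∈ S ω}) P

end

/-! Vectorized, the Tucker product is the action of `kroneckerPi A`, a matrix U with orthonormal
columns. Its rows have squared norm at most the maximum L in p_*: incoherence bounds all modes but
one, and orthonormality bounds the last by 1. So the claim is one about least squares on randomly
observed rows, `IsBernoulliSample.residualSumSq_le`.

Let e be the residual of the full solution and z the coefficient error of a sampled one. Since Uᵀe =
0, the normal equations bound the observed energy of Uz by ⟨z, b⟩, where b = Uᵀ((1_s - p)e) is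
centered with E‖b‖² ≤ pL‖e‖². If the observed Gram matrix exceeds p/2 in every direction and ‖b‖² ≤
(7/8)p²‖e‖², then Cauchy–Schwarz gives ‖z‖² ≤ (7/2)‖e‖², and Pythagoras gives the squared ratio 1 +
7/2 = (3/√2)².

Markov controls b. The Gram matrix needs a matrix Chernoff bound, `IsBernoulliSample.lowerTail`,
obtained by interpolating in p: Russo's formula differentiates the mean of tr exp(θQ), with Q the
unobserved Gram matrix, and `sum_expTrace_diff` bounds that derivative by -θ(1 - θL/2) times the
mean. The exponential enters only through its power series, so rank-one comparisons of tr Qⁿ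
suffice. -/

/-! ### Moments and traces of powers of positive semidefinite matrices -/

section Matrices
open Matrix
variable {κ : Type*} [Fintype κ] [DecidableEq κ]

/-- Powers of a positive semidefinite real matrix in an orthonormal eigenbasis. -/
theorem Matrix.PosSemidef.exists_pow_eq {Q : Matrix κ κ ℝ} (hQ : Q.PosSemidef) :
    ∃ (d : κ → ℝ) (W : Matrix κ κ ℝ), (∀ j, 0 ≤ d j) ∧ Wᵀ * W = 1 ∧ W * Wᵀ = 1 ∧
      ∀ n : ℕ, Q ^ n = W * diagonal (fun j => d j ^ n) * Wᵀ := by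
  obtain ⟨W, hW⟩ : ∃ W : Matrix κ κ ℝ, W = (hQ.1.eigenvectorUnitary : Matrix κ κ ℝ) := ⟨_, rfl⟩
  have h1 : Wᵀ * W = 1 := by
    have := Unitary.coe_star_mul_self hQ.1.eigenvectorUnitary
    rw [← hW] at this
    simpa [star_eq_conjTranspose, conjTranspose_eq_transpose_of_trivial] using this
  have h2 : W * Wᵀ = 1 := mul_eq_one_comm.mp h1
  have h3 : Q = W * diagonal hQ.1.eigenvalues * Wᵀ := by
    have := hQ.1.spectral_theorem
    rw [Unitary.conjStarAlgAut_apply, ← hW] at this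
    simpa [star_eq_conjTranspose, conjTranspose_eq_transpose_of_trivial, Function.comp_def]
      using this
  have h4 := hQ.eigenvalues_nonneg
  generalize hQ.1.eigenvalues = d at h3 h4
  refine ⟨d, W, h4, h1, h2, fun n => ?_⟩
  induction n with
  | zero => simp [h2]
  | succ n ih =>
    rw [pow_succ, ih]
    nth_rewrite 1 [h3]
    calc _ = W * diagonal (fun j => d j ^ n) * (Wᵀ * W) * diagonal d * Wᵀ := by
          simp only [Matrix.mul_assoc]
      _ = _ := by
        rw [h1, Matrix.mul_one, Matrix.mul_assoc W, diagonal_mul_diagonal]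
        simp only [pow_succ]

theorem Matrix.dotProduct_mul_diagonal_mul (W : Matrix κ κ ℝ) (d x : κ → ℝ) :
    x ⬝ᵥ (W * diagonal d * Wᵀ) *ᵥ x = ∑ j, d j * (Wᵀ *ᵥ x) j ^ 2 := by
  rw [← mulVec_mulVec, ← mulVec_mulVec, dotProduct_mulVec, ← mulVec_transpose, dotProduct]
  exact Finset.sum_congr rfl fun j _ => by rw [mulVec_diagonal]; ring

theorem Matrix.PosSemidef.dotProduct_pow_nonneg {Q : Matrix κ κ ℝ} (hQ : Q.PosSemidef)
    (u : κ → ℝ) (n : ℕ) : 0 ≤ u ⬝ᵥ (Q ^ n) *ᵥ u := by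
  simpa using (hQ.pow n).dotProduct_mulVec_nonneg u

/-- Chebyshev's association inequality for the moments of a positive semidefinite matrix. -/
theorem Matrix.PosSemidef.moment_mul_le {Q : Matrix κ κ ℝ} (hQ : Q.PosSemidef) (u : κ → ℝ)
    (a b : ℕ) :
    (u ⬝ᵥ (Q ^ a) *ᵥ u) * (u ⬝ᵥ (Q ^ b) *ᵥ u) ≤ (u ⬝ᵥ u) * (u ⬝ᵥ (Q ^ (a + b)) *ᵥ u) := by
  obtain ⟨d, W, hd, -, -, h⟩ := hQ.exists_pow_eq
  have h0 : u ⬝ᵥ u = u ⬝ᵥ (Q ^ 0) *ᵥ u := by simp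
  rw [h0]
  simp only [h, dotProduct_mul_diagonal_mul]
  set w : κ → ℝ := fun j => (Wᵀ *ᵥ u) j ^ 2
  have hw : ∀ j, 0 ≤ w j := fun j => sq_nonneg _
  -- Symmetrized form: both powers increase with the eigenvalue, so the two differences have the
  -- same sign.
  have key : 0 ≤ ∑ i, ∑ j, w i * w j * ((d i ^ a - d j ^ a) * (d i ^ b - d j ^ b)) := by
    refine Finset.sum_nonneg fun i _ => Finset.sum_nonneg fun j _ =>
      mul_nonneg (mul_nonneg (hw i) (hw j)) ?_
    rcases le_total (d i) (d j) with hij | hij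
    · exact mul_nonneg_of_nonpos_of_nonpos
        (sub_nonpos.2 (pow_le_pow_left₀ (hd i) hij a)) (sub_nonpos.2 (pow_le_pow_left₀ (hd i) hij b))
    · exact mul_nonneg (sub_nonneg.2 (pow_le_pow_left₀ (hd j) hij a))
        (sub_nonneg.2 (pow_le_pow_left₀ (hd j) hij b))
  have e1 : ∑ i, ∑ j, w i * w j * ((d i ^ a - d j ^ a) * (d i ^ b - d j ^ b))
      = 2 * ((∑ j, d j ^ 0 * w j) * ∑ j, d j ^ (a + b) * w j)
        - 2 * ((∑ j, d j ^ a * w j) * ∑ j, d j ^ b * w j) := by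
    have e2 : ∀ x y : ℕ, (∑ j, d j ^ x * w j) * ∑ j, d j ^ y * w j
        = ∑ i, ∑ j, (d i ^ x * w i) * (d j ^ y * w j) := fun x y => Finset.sum_mul_sum _ _ _ _
    have e3 := e2 (a + b) 0
    have e4 := e2 b a
    rw [mul_comm] at e3 e4
    rw [two_mul, two_mul]
    nth_rewrite 1 [e3]
    nth_rewrite 1 [e4]
    rw [e2, e2]
    simp only [← Finset.sum_add_distrib, ← Finset.sum_sub_distrib]
    exact Finset.sum_congr rfl fun i _ => Finset.sum_congr rfl fun j _ => by ring
  linarith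

/-- Jensen's inequality for the powers of a positive semidefinite matrix. -/
theorem Matrix.PosSemidef.pow_le_trace_pow {Q : Matrix κ κ ℝ} (hQ : Q.PosSemidef) {v : κ → ℝ}
    (hv : v ⬝ᵥ v = 1) (n : ℕ) : (v ⬝ᵥ Q *ᵥ v) ^ n ≤ (Q ^ n).trace := by
  obtain ⟨d, W, hd, h1, h2, h⟩ := hQ.exists_pow_eq
  have e1 := h 1
  rw [pow_one] at e1
  have htr : (Q ^ n).trace = ∑ j, d j ^ n := by
    rw [h, trace_mul_comm, ← Matrix.mul_assoc, h1, Matrix.one_mul, trace_diagonal]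
  -- The squared coordinates of v in the eigenbasis are the probability weights for Jensen; the
  -- zeroth power gives their sum.
  have hw : ∑ j, (Wᵀ *ᵥ v) j ^ 2 = 1 := by
    have e0 := congrArg (fun M => v ⬝ᵥ M *ᵥ v) (h 0)
    simp only [dotProduct_mul_diagonal_mul, pow_zero, one_mulVec, one_mul] at e0
    rw [← e0, hv]
  have hw1 : ∀ j, (Wᵀ *ᵥ v) j ^ 2 ≤ 1 := fun j =>
    hw ▸ Finset.single_le_sum (f := fun j => (Wᵀ *ᵥ v) j ^ 2) (fun _ _ => sq_nonneg _)
      (Finset.mem_univ j)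
  rw [htr, e1, dotProduct_mul_diagonal_mul]
  calc (∑ j, d j ^ 1 * (Wᵀ *ᵥ v) j ^ 2) ^ n = (∑ j, (Wᵀ *ᵥ v) j ^ 2 * d j) ^ n := by
        simp only [pow_one, mul_comm]
    _ ≤ ∑ j, (Wᵀ *ᵥ v) j ^ 2 * d j ^ n :=
        Real.pow_arith_mean_le_arith_mean_pow _ _ _ (fun _ _ => sq_nonneg _) hw
          (fun j _ => hd j) n
    _ ≤ ∑ j, d j ^ n := Finset.sum_le_sum fun j _ =>
        mul_le_of_le_one_left (pow_nonneg (hd j) n) (hw1 j)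

/-- The exponential series of the traces of powers. -/
noncomputable def expTrace (θ : ℝ) (Q : Matrix κ κ ℝ) : ℝ := ∑' n : ℕ, θ ^ n / n.factorial * (Q ^ n).trace

theorem Matrix.PosSemidef.summable_expTrace {Q : Matrix κ κ ℝ} (hQ : Q.PosSemidef) (θ : ℝ) :
    Summable fun n : ℕ => θ ^ n / n.factorial * (Q ^ n).trace := by
  obtain ⟨d, W, hd, h1, h2, h⟩ := hQ.exists_pow_eq
  have htr : ∀ n, (Q ^ n).trace = ∑ j, d j ^ n := fun n => by
    rw [h, trace_mul_comm, ← Matrix.mul_assoc, h1, Matrix.one_mul, trace_diagonal]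
  simp only [htr, Finset.mul_sum]
  refine summable_sum fun j _ => ?_
  refine (Real.summable_pow_div_factorial (θ * d j)).congr fun n => ?_
  rw [mul_pow]; ring

theorem Matrix.PosSemidef.exp_le_expTrace {Q : Matrix κ κ ℝ} (hQ : Q.PosSemidef) {θ : ℝ}
    (hθ : 0 ≤ θ) {v : κ → ℝ} (hv : v ⬝ᵥ v = 1) :
    Real.exp (θ * (v ⬝ᵥ Q *ᵥ v)) ≤ expTrace θ Q := by
  rw [Real.exp_eq_exp_ℝ, NormedSpace.exp_eq_tsum_div]
  refine Summable.tsum_le_tsum (fun n => ?_) (Real.summable_pow_div_factorial _)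
    (hQ.summable_expTrace θ)
  rw [mul_pow, mul_div_right_comm]
  exact mul_le_mul_of_nonneg_left (hQ.pow_le_trace_pow hv n) (by positivity)

theorem Matrix.PosSemidef.expTrace_nonneg {Q : Matrix κ κ ℝ} (hQ : Q.PosSemidef) {θ : ℝ}
    (hθ : 0 ≤ θ) : 0 ≤ expTrace θ Q :=
  tsum_nonneg fun n => mul_nonneg (by positivity) (hQ.pow n).trace_nonneg

theorem expTrace_one (θ : ℝ) :
    expTrace θ (1 : Matrix κ κ ℝ) = Fintype.card κ * Real.exp θ := by
  rw [Real.exp_eq_exp_ℝ, NormedSpace.exp_eq_tsum_div, ← tsum_mul_left]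
  exact tsum_congr fun n => by simp [mul_comm]

/-! ### Trace powers under a rank-one update -/

section RankOne
variable {Q Q' : Matrix κ κ ℝ} {u : κ → ℝ}

/-- The exchange rule: trading one factor Q for Q' costs a product of two pure moments. Iterating it
compares mixed moments with pure ones. -/
theorem mixedMoment_succ (h : Q = Q' + vecMulVec u u) (a b : ℕ) :
    u ⬝ᵥ (Q' ^ a * Q ^ (b + 1)) *ᵥ u = u ⬝ᵥ (Q' ^ (a + 1) * Q ^ b) *ᵥ u
      + (u ⬝ᵥ (Q' ^ a) *ᵥ u) * (u ⬝ᵥ (Q ^ b) *ᵥ u) := by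
  have e : Q' ^ a * Q ^ (b + 1) = Q' ^ (a + 1) * Q ^ b + Q' ^ a * vecMulVec u u * Q ^ b := by
    rw [pow_succ', pow_succ, ← Matrix.mul_assoc]
    nth_rewrite 1 [h]
    rw [Matrix.mul_add, Matrix.add_mul]
  rw [e, add_mulVec, dotProduct_add]
  congr 1
  rw [← mulVec_mulVec, ← mulVec_mulVec, vecMulVec_mulVec, mulVec_smul, dotProduct_smul]
  simp [mul_comm]

theorem trace_mixed_succ (hQ : Q.PosSemidef) (hQ' : Q'.PosSemidef) (h : Q = Q' + vecMulVec u u)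
    (a b : ℕ) : (Q' ^ a * Q ^ (b + 1)).trace = (Q' ^ (a + 1) * Q ^ b).trace
      + u ⬝ᵥ (Q' ^ a * Q ^ b) *ᵥ u := by
  have e : Q' ^ a * Q ^ (b + 1) = Q' ^ (a + 1) * Q ^ b + Q' ^ a * vecMulVec u u * Q ^ b := by
    rw [pow_succ', pow_succ, ← Matrix.mul_assoc]
    nth_rewrite 1 [h]
    rw [Matrix.mul_add, Matrix.add_mul]
  have t1 : (Q ^ b)ᵀ = Q ^ b := by
    simpa [conjTranspose_eq_transpose_of_trivial] using (hQ.pow b).1.eq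
  have t2 : (Q' ^ a)ᵀ = Q' ^ a := by
    simpa [conjTranspose_eq_transpose_of_trivial] using (hQ'.pow a).1.eq
  rw [e, trace_add, mul_vecMulVec, vecMulVec_mul, trace_vecMulVec]
  congr 1
  rw [← mulVec_mulVec, dotProduct_mulVec, ← mulVec_transpose, ← mulVec_transpose, t1, t2]

/-- Telescoping over words that interpolate from Qⁿ to Q'ⁿ, one factor at a time. -/
theorem trace_pow_sub (hQ : Q.PosSemidef) (hQ' : Q'.PosSemidef) (h : Q = Q' + vecMulVec u u)
    (n : ℕ) : (Q ^ n).trace - (Q' ^ n).trace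
      = ∑ a ∈ Finset.range n, u ⬝ᵥ (Q' ^ a * Q ^ (n - 1 - a)) *ᵥ u := by
  have := Finset.sum_range_sub' (fun a => (Q' ^ a * Q ^ (n - a)).trace) n
  simp only [pow_zero, Matrix.one_mul, Nat.sub_zero, Nat.sub_self, Matrix.mul_one] at this
  rw [← this]
  refine Finset.sum_congr rfl fun a ha => ?_
  obtain ⟨b, rfl⟩ : ∃ b, n = a + 1 + b := Nat.exists_eq_add_of_le (Finset.mem_range.1 ha)
  rw [show a + 1 + b - a = b + 1 by omega, show a + 1 + b - (a + 1) = b by omega,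
    show a + 1 + b - 1 - a = b by omega, trace_mixed_succ hQ hQ' h]
  ring

/-- Each exchange of Q for Q' discards a nonnegative product, so every mixed moment dominates the
pure moment of the smaller matrix. -/
theorem trace_pow_sub_ge_right (hQ : Q.PosSemidef) (hQ' : Q'.PosSemidef)
    (h : Q = Q' + vecMulVec u u) (n : ℕ) :
    n * (u ⬝ᵥ (Q' ^ (n - 1)) *ᵥ u) ≤ (Q ^ n).trace - (Q' ^ n).trace := by
  have key : ∀ b a : ℕ, u ⬝ᵥ (Q' ^ (a + b)) *ᵥ u ≤ u ⬝ᵥ (Q' ^ a * Q ^ b) *ᵥ u := by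
    intro b
    induction b with
    | zero => simp
    | succ b ih =>
      intro a
      have := ih (a + 1)
      rw [mixedMoment_succ h, show a + (b + 1) = a + 1 + b by ring]
      have := mul_nonneg (hQ'.dotProduct_pow_nonneg u a) (hQ.dotProduct_pow_nonneg u b)
      linarith
  rw [trace_pow_sub hQ hQ' h, ← nsmul_eq_mul]
  nth_rewrite 1 [← Finset.card_range n]
  refine Finset.card_nsmul_le_sum _ _ _ fun a ha => ?_
  have := key (n - 1 - a) a
  rwa [show a + (n - 1 - a) = n - 1 by have := Finset.mem_range.1 ha; omega] at this

/-- Here the bound is in terms of the larger matrix. Each of the a exchanges costs at most ‖u‖²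
times a moment of Q, by Chebyshev's association inequality; summing a over `range n` gives n(n -
1)/2. -/
theorem trace_pow_sub_ge_left (hQ : Q.PosSemidef) (hQ' : Q'.PosSemidef)
    (h : Q = Q' + vecMulVec u u) (n : ℕ) :
    n * (u ⬝ᵥ (Q ^ (n - 1)) *ᵥ u)
      - n * (n - 1) / 2 * ((u ⬝ᵥ u) * (u ⬝ᵥ (Q ^ (n - 2)) *ᵥ u))
      ≤ (Q ^ n).trace - (Q' ^ n).trace := by
  have le : ∀ a b : ℕ, u ⬝ᵥ (Q' ^ a * Q ^ b) *ᵥ u ≤ u ⬝ᵥ (Q ^ (a + b)) *ᵥ u := by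
    intro a
    induction a with
    | zero => simp
    | succ a ih =>
      intro b
      have h1 := ih (b + 1)
      rw [mixedMoment_succ h, show a + (b + 1) = a + 1 + b by ring] at h1
      have := mul_nonneg (hQ'.dotProduct_pow_nonneg u a) (hQ.dotProduct_pow_nonneg u b)
      linarith
  have key : ∀ a b : ℕ, u ⬝ᵥ (Q ^ (a + b)) *ᵥ u
      - a * ((u ⬝ᵥ u) * (u ⬝ᵥ (Q ^ (a + b - 1)) *ᵥ u)) ≤ u ⬝ᵥ (Q' ^ a * Q ^ b) *ᵥ u := by
    intro a
    induction a with
    | zero => simp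
    | succ a ih =>
      intro b
      have h1 := ih (b + 1)
      rw [mixedMoment_succ h, show a + (b + 1) = a + 1 + b by ring,
        show a + 1 + b - 1 = a + b by omega] at h1
      have h2 : (u ⬝ᵥ (Q' ^ a) *ᵥ u) * (u ⬝ᵥ (Q ^ b) *ᵥ u)
          ≤ (u ⬝ᵥ u) * (u ⬝ᵥ (Q ^ (a + b)) *ᵥ u) := by
        refine le_trans ?_ (hQ.moment_mul_le u a b)
        exact mul_le_mul_of_nonneg_right (by simpa using le a 0) (hQ.dotProduct_pow_nonneg u b)
      rw [show a + 1 + b - 1 = a + b by omega]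
      push_cast
      linarith
  rw [trace_pow_sub hQ hQ' h]
  have hs : ∑ a ∈ Finset.range n, (a : ℝ) = n * (n - 1) / 2 := by
    have := Finset.sum_range_id_mul_two n
    rcases n with _ | n
    · simp
    · have h2 : ((∑ a ∈ Finset.range (n + 1), a : ℕ) : ℝ) * 2 = (n + 1) * n := by
        exact_mod_cast this
      push_cast at h2 ⊢
      linarith
  have : ∑ a ∈ Finset.range n, (u ⬝ᵥ (Q ^ (n - 1)) *ᵥ u
      - a * ((u ⬝ᵥ u) * (u ⬝ᵥ (Q ^ (n - 2)) *ᵥ u)))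
      = n * (u ⬝ᵥ (Q ^ (n - 1)) *ᵥ u)
      - n * (n - 1) / 2 * ((u ⬝ᵥ u) * (u ⬝ᵥ (Q ^ (n - 2)) *ᵥ u)) := by
    rw [Finset.sum_sub_distrib, ← Finset.sum_mul, hs]
    simp
  rw [← this]
  refine Finset.sum_le_sum fun a ha => ?_
  have := key a (n - 1 - a)
  rwa [show a + (n - 1 - a) = n - 1 by have := Finset.mem_range.1 ha; omega,
    show n - 1 - 1 = n - 2 by omega] at this

end RankOne
end Matrices

/-! ### Bernoulli samples: Russo's formula, variance, Markov's inequality -/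

section Bernoulli
variable {ι : Type*} [DecidableEq ι]

/-- The probability that a Bernoulli sample with parameter `p`, restricted to `u`, agrees
with `s` on `u`. -/
def bernoulliWeight (p : ℝ) (u s : Finset ι) : ℝ := ∏ i ∈ u, if i ∈ s then p else 1 - p

theorem bernoulliWeight_nonneg {p : ℝ} (h0 : 0 ≤ p) (h1 : p ≤ 1) (u s : Finset ι) :
    0 ≤ bernoulliWeight p u s :=
  Finset.prod_nonneg fun i _ => by split_ifs <;> linarith

variable [Fintype ι]

/-- The expectation of `f` over a Bernoulli sample with parameter `p`. -/
def bernoulliMean (p : ℝ) (f : Finset ι → ℝ) : ℝ :=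
  ∑ s, bernoulliWeight p Finset.univ s * f s

theorem bernoulliWeight_insert (p : ℝ) (i : ι) (t : Finset ι) :
    bernoulliWeight p (Finset.univ.erase i) (insert i t)
      = bernoulliWeight p (Finset.univ.erase i) t :=
  Finset.prod_congr rfl fun j hj => by simp [Finset.ne_of_mem_erase hj]

theorem bernoulliWeight_univ (p : ℝ) (i : ι) (s : Finset ι) :
    bernoulliWeight p Finset.univ s
      = bernoulliWeight p (Finset.univ.erase i) s * if i ∈ s then p else 1 - p :=
  (Finset.prod_erase_mul _ _ (Finset.mem_univ i)).symm

theorem Finset.sum_univ_eq_sum_powerset_erase (i : ι) (F : Finset ι → ℝ) :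
    ∑ s, F s = ∑ t ∈ (Finset.univ.erase i).powerset, (F t + F (insert i t)) := by
  rw [Finset.sum_add_distrib, ← Finset.sum_powerset_insert (Finset.notMem_erase i _),
    Finset.insert_erase (Finset.mem_univ i), Finset.powerset_univ]

/-- Conditioning on every coordinate except i. -/
theorem bernoulliMean_eq_sum_erase (p : ℝ) (i : ι) (f : Finset ι → ℝ) :
    bernoulliMean p f = ∑ t ∈ (Finset.univ.erase i).powerset,
      bernoulliWeight p (Finset.univ.erase i) t * (p * f (insert i t) + (1 - p) * f t) := by
  rw [bernoulliMean, Finset.sum_univ_eq_sum_powerset_erase i]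
  refine Finset.sum_congr rfl fun t ht => ?_
  have hi : i ∉ t := fun h => Finset.notMem_erase i _ (Finset.mem_powerset.1 ht h)
  rw [bernoulliWeight_univ p i, bernoulliWeight_univ p i, bernoulliWeight_insert]
  simp only [hi, if_false, Finset.mem_insert_self, if_true]
  ring

theorem bernoulliMean_mono {p : ℝ} (h0 : 0 ≤ p) (h1 : p ≤ 1) {f g : Finset ι → ℝ}
    (h : ∀ s, f s ≤ g s) : bernoulliMean p f ≤ bernoulliMean p g :=
  Finset.sum_le_sum fun s _ => mul_le_mul_of_nonneg_left (h s) (bernoulliWeight_nonneg h0 h1 _ _)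

theorem bernoulliMean_sum (p : ℝ) {α : Type*} (a : Finset α) (f : α → Finset ι → ℝ) :
    bernoulliMean p (fun s => ∑ x ∈ a, f x s) = ∑ x ∈ a, bernoulliMean p (f x) := by
  simp only [bernoulliMean, Finset.mul_sum]
  exact Finset.sum_comm

theorem bernoulliMean_const_mul (p c : ℝ) (f : Finset ι → ℝ) :
    bernoulliMean p (fun s => c * f s) = c * bernoulliMean p f := by
  simp only [bernoulliMean, Finset.mul_sum]
  exact Finset.sum_congr rfl fun s _ => by ring

theorem bernoulliMean_one (p : ℝ) : bernoulliMean p (fun _ : Finset ι => 1) = 1 := by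
  have := Fintype.prod_add (fun _ : ι => p) (fun _ => 1 - p)
  simp only [add_sub_cancel, Finset.prod_const_one] at this
  refine Eq.trans ?_ this.symm
  refine Finset.sum_congr rfl fun s _ => ?_
  rw [mul_one, bernoulliWeight, ← Finset.prod_mul_prod_compl s]
  congr 1
  · exact Finset.prod_congr rfl fun i hi => by simp [hi]
  · exact Finset.prod_congr rfl fun i hi => by simp [Finset.mem_compl.1 hi]

theorem bernoulliMean_zero (f : Finset ι → ℝ) : bernoulliMean 0 f = f ∅ := by
  rw [bernoulliMean, Finset.sum_eq_single ∅]
  · simp [bernoulliWeight]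
  · intro s _ hs
    obtain ⟨i, hi⟩ := Finset.nonempty_iff_ne_empty.2 hs
    rw [bernoulliWeight, Finset.prod_eq_zero (Finset.mem_univ i) (by simp [hi]), zero_mul]
  · simp

/-- Russo's formula. -/
theorem hasDerivAt_bernoulliMean (f : Finset ι → ℝ) (p : ℝ) :
    HasDerivAt (fun p => bernoulliMean p f)
      (∑ i, bernoulliMean p (fun s => f (insert i s) - f (s.erase i))) p := by
  have h1 : ∀ s : Finset ι, HasDerivAt (fun p => bernoulliWeight p Finset.univ s)
      (∑ i, bernoulliWeight p (Finset.univ.erase i) s * (if i ∈ s then 1 else -1)) p := by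
    intro s
    have := HasDerivAt.fun_finsetProd (u := (Finset.univ : Finset ι))
      (f := fun i p => if i ∈ s then p else 1 - p)
      (f' := fun i => if i ∈ s then 1 else -1) (x := p) (fun i _ => by
        by_cases hi : i ∈ s
        · simpa [hi] using hasDerivAt_id' p
        · simpa [hi] using (hasDerivAt_id' p).const_sub 1)
    simpa [bernoulliWeight] using this
  have h2 := HasDerivAt.fun_sum (u := (Finset.univ : Finset (Finset ι)))
    (fun s _ => (h1 s).mul_const (f s))
  refine h2.congr_deriv ?_
  simp only [Finset.sum_mul]
  rw [Finset.sum_comm]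
  refine Finset.sum_congr rfl fun i _ => ?_
  rw [bernoulliMean_eq_sum_erase p i, Finset.sum_univ_eq_sum_powerset_erase i]
  refine Finset.sum_congr rfl fun t ht => ?_
  have hi : i ∉ t := fun h => Finset.notMem_erase i _ (Finset.mem_powerset.1 ht h)
  rw [bernoulliWeight_insert]
  simp only [hi, if_false, Finset.mem_insert_self, if_true, Finset.insert_idem,
    Finset.erase_insert hi, Finset.erase_eq_of_notMem hi]
  ring

theorem bernoulliMean_centered_mul (p : ℝ) (i k : ι) :
    bernoulliMean p (fun s => ((if i ∈ s then 1 else 0) - p) * ((if k ∈ s then 1 else 0) - p))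
      = if i = k then p * (1 - p) else 0 := by
  rw [bernoulliMean_eq_sum_erase p i]
  split_ifs with h
  · subst h
    have := bernoulliMean_one (ι := ι) p
    rw [bernoulliMean_eq_sum_erase p i] at this
    refine Eq.trans ?_ ((congrArg (p * (1 - p) * ·) this).trans (mul_one _))
    rw [Finset.mul_sum]
    refine Finset.sum_congr rfl fun t ht => ?_
    have hi : i ∉ t := fun h => Finset.notMem_erase i _ (Finset.mem_powerset.1 ht h)
    simp only [hi, if_false, Finset.mem_insert_self, if_true]
    ring
  · refine Finset.sum_eq_zero fun t ht => ?_
    have hi : i ∉ t := fun h => Finset.notMem_erase i _ (Finset.mem_powerset.1 ht h)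
    simp only [hi, if_false, Finset.mem_insert_self, if_true, Finset.mem_insert, Ne.symm h,
      false_or]
    ring

/-- The variance of a linear combination of independent Bernoulli variables. -/
theorem bernoulliMean_sq (p : ℝ) (c : ι → ℝ) :
    bernoulliMean p (fun s => (∑ i, ((if i ∈ s then 1 else 0) - p) * c i) ^ 2)
      = p * (1 - p) * ∑ i, c i ^ 2 := by
  have : ∀ s : Finset ι, (∑ i, ((if i ∈ s then 1 else 0) - p) * c i) ^ 2
      = ∑ i, ∑ k, (c i * c k) *
        (((if i ∈ s then 1 else 0) - p) * ((if k ∈ s then 1 else 0) - p)) := fun s => by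
    rw [sq, Finset.sum_mul_sum]
    exact Finset.sum_congr rfl fun i _ => Finset.sum_congr rfl fun k _ => by ring
  simp only [this, bernoulliMean_sum, bernoulliMean_const_mul, bernoulliMean_centered_mul]
  simp only [mul_ite, mul_zero, Finset.sum_ite_eq, Finset.mem_univ, if_true, Finset.mul_sum]
  exact Finset.sum_congr rfl fun i _ => by ring

theorem IsBernoulliSample.measureReal_eq {Ω : Type*} [MeasurableSpace Ω] {P : Measure Ω}
    {S : Ω → Set ι} {p : ℝ} [IsProbabilityMeasure P] (hS : IsBernoulliSample P S p)
    (s : Finset ι) : P.real {ω | S ω = s} = bernoulliWeight p Finset.univ s := by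
  have h1 : {ω | S ω = s} = ⋂ i, if i ∈ s then {ω | i ∈ S ω} else {ω | i ∈ S ω}ᶜ := by
    ext ω
    simp only [Set.mem_ofPred_eq, Set.mem_iInter, Set.ext_iff, Finset.mem_coe]
    refine forall_congr' fun i => ?_
    by_cases hi : i ∈ s <;> simp [hi]
  have hind := (iIndepSet_iff_iIndep _ _).1 hS.indep
  have h2 := hind.meas_iInter (s := fun i => if i ∈ s then {ω | i ∈ S ω} else {ω | i ∈ S ω}ᶜ)
    (fun i => by
      have : MeasurableSet[MeasurableSpace.generateFrom {{ω | i ∈ S ω}}] {ω | i ∈ S ω} :=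
        MeasurableSpace.measurableSet_generateFrom rfl
      split_ifs
      · exact this
      · exact this.compl)
  rw [h1, measureReal_def, h2, ENNReal.toReal_prod, bernoulliWeight]
  refine Finset.prod_congr rfl fun i _ => ?_
  split_ifs
  · exact hS.prob i
  · rw [← measureReal_def, probReal_compl_eq_one_sub (hS.measurable i), hS.prob i]

/-- Markov's inequality for a Bernoulli sample. -/
theorem IsBernoulliSample.mul_measureReal_le {Ω : Type*} [MeasurableSpace Ω] {P : Measure Ω}
    {S : Ω → Set ι} {p : ℝ} [IsProbabilityMeasure P] (hS : IsBernoulliSample P S p)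
    (h0 : 0 ≤ p) (h1 : p ≤ 1) {f : Finset ι → ℝ} (hf : ∀ s, 0 ≤ f s) {τ : ℝ} (hτ : 0 ≤ τ) :
    τ * P.real {ω | ∀ s : Finset ι, S ω = s → τ ≤ f s} ≤ bernoulliMean p f := by
  classical
  set F : Finset (Finset ι) := {s | τ ≤ f s}
  have hsub : {ω | ∀ s : Finset ι, S ω = s → τ ≤ f s} ⊆ ⋃ s ∈ F, {ω | S ω = s} := by
    intro ω hω
    have : S ω = (S ω).toFinset := by simp
    simp only [Set.mem_iUnion]
    exact ⟨_, by simpa [F] using hω _ this, this⟩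
  calc _ ≤ τ * ∑ s ∈ F, P.real {ω | S ω = s} := by
        refine mul_le_mul_of_nonneg_left ?_ hτ
        exact (measureReal_mono hsub (measure_ne_top _ _)).trans (measureReal_biUnion_finset_le _ _)
    _ = ∑ s ∈ F, bernoulliWeight p Finset.univ s * τ := by
        rw [Finset.mul_sum]
        exact Finset.sum_congr rfl fun s _ => by rw [hS.measureReal_eq, mul_comm]
    _ ≤ ∑ s ∈ F, bernoulliWeight p Finset.univ s * f s := Finset.sum_le_sum fun s hs =>
        mul_le_mul_of_nonneg_left (by simpa [F] using hs) (bernoulliWeight_nonneg h0 h1 _ _)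
    _ ≤ _ := Finset.sum_le_sum_of_subset_of_nonneg (Finset.subset_univ _) fun s _ _ =>
        mul_nonneg (bernoulliWeight_nonneg h0 h1 _ _) (hf s)

end Bernoulli

/-! ### Matrix Chernoff bound for the observed Gram matrix -/

section LowerTail
open Matrix
variable {ι κ : Type*}

/-- The Gram matrix of the rows of `U` with index in `s`. -/
def rowGram (U : Matrix ι κ ℝ) (s : Finset ι) : Matrix κ κ ℝ :=
  ∑ i ∈ s, vecMulVec (U i) (U i)

theorem posSemidef_rowGram [Finite κ] (U : Matrix ι κ ℝ) (s : Finset ι) : (rowGram U s).PosSemidef :=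
  posSemidef_sum s fun i _ => by simpa using posSemidef_vecMulVec_self_star (U i)

theorem rowGram_univ [Fintype ι] (U : Matrix ι κ ℝ) : rowGram U Finset.univ = Uᵀ * U := by
  ext j k
  simp [rowGram, Matrix.sum_apply, vecMulVec_apply, Matrix.mul_apply]

theorem dotProduct_rowGram_mulVec [Fintype κ] (U : Matrix ι κ ℝ) (s : Finset ι) (x : κ → ℝ) :
    x ⬝ᵥ rowGram U s *ᵥ x = ∑ i ∈ s, (U *ᵥ x) i ^ 2 := by
  rw [rowGram, Matrix.sum_mulVec, dotProduct_sum]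
  refine Finset.sum_congr rfl fun i _ => ?_
  rw [vecMulVec_mulVec, dotProduct_smul, mulVec, dotProduct_comm x]
  simp [sq]

theorem rowGram_insert_eq [DecidableEq ι] (U : Matrix ι κ ℝ) (s : Finset ι) (i : ι) :
    rowGram U (insert i s) = rowGram U (s.erase i) + vecMulVec (U i) (U i) := by
  unfold rowGram
  rw [← Finset.sum_erase_add _ _ (Finset.mem_insert_self i s), Finset.erase_insert_eq_erase]

variable [Fintype κ] [DecidableEq κ]

/-- One bound in terms of the Gram matrix of s itself, whether or not i lies in s: that matrix is
the larger of the pair if i ∈ s and the smaller otherwise, which decides the rank-one comparison to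
use. -/
theorem trace_pow_rowGram_diff [DecidableEq ι] {U : Matrix ι κ ℝ} {L : ℝ} (hL : ∀ i, U i ⬝ᵥ U i ≤ L)
    (s : Finset ι) (i : ι) (n : ℕ) :
    n * (U i ⬝ᵥ (rowGram U s ^ (n - 1)) *ᵥ U i)
      - n * (n - 1) / 2 * (L * (U i ⬝ᵥ (rowGram U s ^ (n - 2)) *ᵥ U i))
      ≤ (rowGram U (insert i s) ^ n).trace - (rowGram U (s.erase i) ^ n).trace := by
  have hn : (0 : ℝ) ≤ n * (n - 1) / 2 := by
    rcases n with _ | n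
    · simp
    · push_cast; rw [add_sub_cancel_right]; positivity
  have hm := (posSemidef_rowGram U s).dotProduct_pow_nonneg (U i) (n - 2)
  have h := rowGram_insert_eq U s i
  have p1 := posSemidef_rowGram U (insert i s)
  have p2 := posSemidef_rowGram U (s.erase i)
  by_cases hi : i ∈ s
  · have := trace_pow_sub_ge_left p1 p2 h n
    rw [Finset.insert_eq_of_mem hi] at this ⊢
    have h3 := mul_le_mul_of_nonneg_left (mul_le_mul_of_nonneg_right (hL i) hm) hn
    linarith
  · have := trace_pow_sub_ge_right p1 p2 h n
    rw [Finset.erase_eq_of_notMem hi] at this ⊢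
    have hL0 : 0 ≤ L := by
      simpa using (Matrix.PosSemidef.one.dotProduct_pow_nonneg (U i) 0).trans (by simpa using hL i)
    have h3 := mul_nonneg hn (mul_nonneg hL0 hm)
    linarith

variable [Fintype ι]

theorem sum_dotProduct_mulVec_row {U : Matrix ι κ ℝ} (hU : Uᵀ * U = 1) (M : Matrix κ κ ℝ) :
    ∑ i, U i ⬝ᵥ M *ᵥ U i = M.trace := by
  calc ∑ i, U i ⬝ᵥ M *ᵥ U i = (M * rowGram U Finset.univ).trace := by
        rw [rowGram, Matrix.mul_sum, trace_sum]
        refine Finset.sum_congr rfl fun i _ => ?_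
        rw [mul_vecMulVec, trace_vecMulVec, dotProduct_comm]
    _ = M.trace := by rw [rowGram_univ, hU, Matrix.mul_one]

variable [DecidableEq ι]

/-- Summed over i, the row moments become traces because UᵀU = 1. In the exponential series the
factors n and n(n - 1)/2 then shift the index by one and two, producing θ and θ²L/2. -/
theorem sum_expTrace_diff {U : Matrix ι κ ℝ} (hU : Uᵀ * U = 1) {L : ℝ}
    (hL : ∀ i, U i ⬝ᵥ U i ≤ L) {θ : ℝ} (hθ : 0 ≤ θ) (s : Finset ι) :
    θ * (1 - θ * L / 2) * expTrace θ (rowGram U s)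
      ≤ ∑ i, (expTrace θ (rowGram U (insert i s)) - expTrace θ (rowGram U (s.erase i))) := by
  have hs := fun s => ((posSemidef_rowGram U s).summable_expTrace θ).hasSum
  have hR : HasSum (fun n : ℕ => θ ^ n / n.factorial *
      ∑ i, ((rowGram U (insert i s) ^ n).trace - (rowGram U (s.erase i) ^ n).trace))
      (∑ i, (expTrace θ (rowGram U (insert i s)) - expTrace θ (rowGram U (s.erase i)))) := by
    have := hasSum_sum (s := Finset.univ) fun i _ => (hs (insert i s)).sub (hs (s.erase i))
    refine this.congr_fun fun n => ?_
    rw [Finset.mul_sum]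
    exact Finset.sum_congr rfl fun i _ => by ring
  set t : ℕ → ℝ := fun n => (rowGram U s ^ n).trace
  have h0 : HasSum (fun n => θ ^ n / n.factorial * t n) (expTrace θ (rowGram U s)) := hs s
  have h1 : HasSum (fun n : ℕ => θ ^ n / n.factorial * (n * t (n - 1)))
      (θ * expTrace θ (rowGram U s)) := by
    rw [← hasSum_nat_add_iff' 1]
    simp only [Finset.range_one, Finset.sum_singleton, Nat.cast_zero, zero_mul, mul_zero, sub_zero]
    refine (h0.mul_left θ).congr_fun fun n => ?_
    rw [Nat.factorial_succ, add_tsub_cancel_right]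
    push_cast
    field_simp
    ring
  have h2 : HasSum (fun n : ℕ => θ ^ n / n.factorial * (n * (n - 1) / 2 * (L * t (n - 2))))
      (θ ^ 2 * L / 2 * expTrace θ (rowGram U s)) := by
    rw [← hasSum_nat_add_iff' 2]
    simp only [Finset.sum_range_succ, Finset.range_zero, Finset.sum_empty, Nat.cast_zero, zero_mul,
      mul_zero, sub_zero, Nat.cast_one, sub_self, add_zero, zero_div]
    refine (h0.mul_left _).congr_fun fun n => ?_
    rw [Nat.factorial_succ, Nat.factorial_succ, add_tsub_cancel_right]
    push_cast
    have : (n : ℝ) + 1 + 1 ≠ 0 := by positivity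
    have : (n : ℝ) + 2 ≠ 0 := by positivity
    field_simp
    ring
  have hL' := h1.sub h2
  have e : θ * (1 - θ * L / 2) * expTrace θ (rowGram U s)
      = θ * expTrace θ (rowGram U s) - θ ^ 2 * L / 2 * expTrace θ (rowGram U s) := by ring
  rw [e]
  refine hasSum_le (fun n => ?_) hL' hR
  rw [← mul_sub]
  refine mul_le_mul_of_nonneg_left ?_ (by positivity)
  have := Finset.sum_le_sum fun i (_ : i ∈ Finset.univ) => trace_pow_rowGram_diff hL s i n
  refine le_trans (le_of_eq ?_) this
  rw [Finset.sum_sub_distrib, ← Finset.mul_sum, ← Finset.mul_sum, ← Finset.mul_sum,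
    sum_dotProduct_mulVec_row hU, sum_dotProduct_mulVec_row hU]

/-- The mean of the exponential trace of the unobserved Gram matrix. -/
theorem bernoulliMean_expTrace_le {U : Matrix ι κ ℝ} (hU : Uᵀ * U = 1) {L : ℝ}
    (hL : ∀ i, U i ⬝ᵥ U i ≤ L) {θ : ℝ} (hθ : 0 ≤ θ) {p : ℝ} (h0 : 0 ≤ p) (h1 : p ≤ 1) :
    bernoulliMean p (fun s => expTrace θ (rowGram U sᶜ))
      ≤ Fintype.card κ * Real.exp (θ - θ * (1 - θ * L / 2) * p) := by
  set c := θ * (1 - θ * L / 2)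
  set f : Finset ι → ℝ := fun s => expTrace θ (rowGram U sᶜ)
  -- Integrating factor: the differential inequality says that exp(cq) times the mean is
  -- nonincreasing in q.
  have hd : ∀ q, HasDerivAt (fun q => Real.exp (c * q) * bernoulliMean q f)
      (Real.exp (c * q) * (c * bernoulliMean q f
        + ∑ i, bernoulliMean q (fun s => f (insert i s) - f (s.erase i)))) q := fun q => by
    have h := (((hasDerivAt_id' q).const_mul c).exp).mul (hasDerivAt_bernoulliMean f q)
    refine h.congr_deriv ?_
    ring
  have hneg : ∀ q, 0 ≤ q → q ≤ 1 → c * bernoulliMean q f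
      + ∑ i, bernoulliMean q (fun s => f (insert i s) - f (s.erase i)) ≤ 0 := by
    intro q hq0 hq1
    rw [← bernoulliMean_sum, ← bernoulliMean_const_mul]
    -- Inserting i into s removes it from the complement, hence the factor -1.
    have := bernoulliMean_mono hq0 hq1 (f := fun s => c * f s)
      (g := fun s => -1 * ∑ i, (f (insert i s) - f (s.erase i))) fun s => by
        refine (sum_expTrace_diff hU hL hθ sᶜ).trans (le_of_eq ?_)
        rw [Finset.mul_sum]
        refine Finset.sum_congr rfl fun i _ => ?_
        simp only [f, Finset.compl_insert, Finset.compl_erase]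
        ring
    rw [bernoulliMean_const_mul (c := -1)] at this
    linarith
  have hanti : AntitoneOn (fun q => Real.exp (c * q) * bernoulliMean q f) (Set.Icc 0 1) := by
    refine antitoneOn_of_deriv_nonpos (convex_Icc 0 1)
      (fun q _ => (hd q).continuousAt.continuousWithinAt)
      (fun q _ => (hd q).differentiableAt.differentiableWithinAt) fun q hq => ?_
    rw [interior_Icc] at hq
    rw [(hd q).deriv]
    exact mul_nonpos_of_nonneg_of_nonpos (Real.exp_pos _).le (hneg q hq.1.le hq.2.le)
  have h := hanti (Set.left_mem_Icc.2 zero_le_one) ⟨h0, h1⟩ h0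
  simp only [mul_zero, Real.exp_zero, one_mul, bernoulliMean_zero] at h
  have hf : f ∅ = Fintype.card κ * Real.exp θ := by
    simp only [f, Finset.compl_empty, rowGram_univ, hU, expTrace_one]
  rw [hf] at h
  rw [Real.exp_sub, mul_div_assoc', le_div_iff₀ (Real.exp_pos _)]
  linarith

/-- A matrix Chernoff bound: with high probability the observed rows carry more than half
of the expected energy in every direction. -/
theorem IsBernoulliSample.lowerTail {Ω : Type*} [MeasurableSpace Ω] {P : Measure Ω}
    [IsProbabilityMeasure P] {S : Ω → Set ι} {p : ℝ} (hS : IsBernoulliSample P S p)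
    (h0 : 0 ≤ p) (h1 : p ≤ 1) {U : Matrix ι κ ℝ} (hU : Uᵀ * U = 1) {L : ℝ} (hL0 : 0 < L)
    (hL : ∀ i, U i ⬝ᵥ U i ≤ L) :
    P.real {ω | ∃ v : κ → ℝ, v ⬝ᵥ v = 1 ∧ ∀ s : Finset ι, S ω = s →
        v ⬝ᵥ rowGram U s *ᵥ v ≤ p / 2}
      ≤ Fintype.card κ * Real.exp (-(p / (8 * L))) := by
  -- This θ minimizes the final exponent -θp/2 + θ²Lp/2, with value -p/(8L).
  set θ := 1 / (2 * L)
  have hθ : 0 ≤ θ := by positivity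
  have hM := hS.mul_measureReal_le h0 h1 (f := fun s => expTrace θ (rowGram U sᶜ))
    (fun s => (posSemidef_rowGram U sᶜ).expTrace_nonneg hθ)
    (Real.exp_pos (θ * (1 - p / 2))).le
  have hsub : {ω | ∃ v : κ → ℝ, v ⬝ᵥ v = 1 ∧ ∀ s : Finset ι, S ω = s →
      v ⬝ᵥ rowGram U s *ᵥ v ≤ p / 2} ⊆ {ω | ∀ s : Finset ι, S ω = s →
        Real.exp (θ * (1 - p / 2)) ≤ expTrace θ (rowGram U sᶜ)} := by
    rintro ω ⟨v, hv, h⟩ s hs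
    refine le_trans (Real.exp_le_exp.2 (mul_le_mul_of_nonneg_left ?_ hθ))
      ((posSemidef_rowGram U sᶜ).exp_le_expTrace hθ hv)
    -- Observed and unobserved energy add up to 1, so little observed energy means a large
    -- unobserved Gram matrix.
    have e : v ⬝ᵥ rowGram U s *ᵥ v + v ⬝ᵥ rowGram U sᶜ *ᵥ v = 1 := by
      rw [dotProduct_rowGram_mulVec, dotProduct_rowGram_mulVec, Finset.sum_add_sum_compl,
        ← dotProduct_rowGram_mulVec, rowGram_univ, hU, one_mulVec, hv]
    have := h s hs
    linarith
  have hle := (mul_le_mul_of_nonneg_left (measureReal_mono hsub (measure_ne_top P _))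
    (Real.exp_pos (θ * (1 - p / 2))).le).trans
    (hM.trans (bernoulliMean_expTrace_le hU hL hθ h0 h1))
  have e : Real.exp (θ - θ * (1 - θ * L / 2) * p)
      = Real.exp (θ * (1 - p / 2)) * Real.exp (-(p / (8 * L))) := by
    rw [← Real.exp_add]
    congr 1
    simp only [θ]
    field_simp
    ring
  rw [e, mul_left_comm] at hle
  exact le_of_mul_le_mul_left hle (Real.exp_pos _)

end LowerTail

/-! ### Least squares on the observed rows -/

section LeastSquares
open Matrix
variable {ι κ : Type*} [Fintype κ]

/-- The residual sum of squares over the rows with index in `s`. -/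
def residualSumSq (U : Matrix ι κ ℝ) (T : ι → ℝ) (s : Finset ι) (x : κ → ℝ) : ℝ :=
  ∑ i ∈ s, ((U *ᵥ x) i - T i) ^ 2

/-- The range of a linear map in finite dimension is closed, so the distance from the data to it is
attained. -/
theorem exists_residualSumSq_le (U : Matrix ι κ ℝ) (T : ι → ℝ) (s : Finset ι) :
    ∃ x, ∀ y, residualSumSq U T s x ≤ residualSumSq U T s y := by
  let F : (κ → ℝ) →ₗ[ℝ] EuclideanSpace ℝ s :=
    (WithLp.linearEquiv 2 ℝ (s → ℝ)).symm.toLinearMap ∘ₗ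
      (LinearMap.funLeft ℝ ℝ (Subtype.val : s → ι)) ∘ₗ U.mulVecLin
  let b : EuclideanSpace ℝ s := WithLp.toLp 2 fun i => T i
  have hF : ∀ x, dist b (F x) = √(residualSumSq U T s x) := fun x => by
    rw [dist_comm, EuclideanSpace.dist_eq, residualSumSq, ← Finset.sum_coe_sort s]
    simp [F, b, Real.dist_eq, sq_abs, LinearMap.funLeft_apply]
  obtain ⟨-, ⟨x, rfl⟩, hx⟩ := (Submodule.closed_of_finiteDimensional
    (LinearMap.range F)).exists_infDist_eq_dist ⟨F 0, LinearMap.mem_range_self F 0⟩ b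
  refine ⟨x, fun y => ?_⟩
  have h := Metric.infDist_le_dist_of_mem (x := b) (LinearMap.mem_range_self F y)
  rw [hx, hF, hF] at h
  exact (Real.sqrt_le_sqrt_iff (Finset.sum_nonneg fun _ _ => sq_nonneg _)).1 h

variable [Fintype ι]

theorem sum_mulVec_mul (U : Matrix ι κ ℝ) (z : κ → ℝ) (e : ι → ℝ) :
    ∑ i, (U *ᵥ z) i * e i = z ⬝ᵥ Uᵀ *ᵥ e := by
  rw [dotProduct_transpose_mulVec, dotProduct_comm]; rfl

/-- The deviation of the observed gradient from its mean, at the full least squares solution. -/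
def gradientNoise [DecidableEq ι] (U : Matrix ι κ ℝ) (e : ι → ℝ) (p : ℝ) (s : Finset ι) : κ → ℝ :=
  Uᵀ *ᵥ fun i => ((if i ∈ s then 1 else 0) - p) * e i

/-- Each coordinate of the noise is a linear combination of independent centered variables; adding
the variances over coordinates collects the squared row norms. -/
theorem bernoulliMean_gradientNoise_le [DecidableEq ι] {U : Matrix ι κ ℝ} {L : ℝ} (hL : ∀ i, U i ⬝ᵥ U i ≤ L)
    (e : ι → ℝ) {p : ℝ} (h0 : 0 ≤ p) :
    bernoulliMean p (fun s => gradientNoise U e p s ⬝ᵥ gradientNoise U e p s)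
      ≤ p * (L * ∑ i, e i ^ 2) := by
  have h : ∀ s, gradientNoise U e p s ⬝ᵥ gradientNoise U e p s
      = ∑ j, (∑ i, ((if i ∈ s then 1 else 0) - p) * (e i * U i j)) ^ 2 := fun s => by
    refine Finset.sum_congr rfl fun j _ => ?_
    rw [sq]
    have : gradientNoise U e p s j = ∑ i, ((if i ∈ s then 1 else 0) - p) * (e i * U i j) :=
      Finset.sum_congr rfl fun i _ => by
        change U i j * (((if i ∈ s then 1 else 0) - p) * e i) = _
        ring
    rw [this]
  simp only [h, bernoulliMean_sum, bernoulliMean_sq]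
  rw [← Finset.mul_sum, Finset.sum_comm, mul_assoc]
  refine mul_le_mul_of_nonneg_left ?_ h0
  have h2 : ∑ i, ∑ j, (e i * U i j) ^ 2 ≤ L * ∑ i, e i ^ 2 := by
    rw [Finset.mul_sum]
    refine Finset.sum_le_sum fun i _ => ?_
    have : ∑ j, (e i * U i j) ^ 2 = (U i ⬝ᵥ U i) * e i ^ 2 := by
      rw [dotProduct, Finset.sum_mul]
      exact Finset.sum_congr rfl fun j _ => by ring
    rw [this]
    exact mul_le_mul_of_nonneg_right (hL i) (sq_nonneg _)
  have h3 : 0 ≤ ∑ i, ∑ j, (e i * U i j) ^ 2 :=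
    Finset.sum_nonneg fun _ _ => Finset.sum_nonneg fun _ _ => sq_nonneg _
  nlinarith

theorem IsBernoulliSample.gradientNoise_tail [DecidableEq ι] {Ω : Type*} [MeasurableSpace Ω] {P : Measure Ω}
    [IsProbabilityMeasure P] {S : Ω → Set ι} {p : ℝ} (hS : IsBernoulliSample P S p)
    (h0 : 0 < p) (h1 : p ≤ 1) {U : Matrix ι κ ℝ} {L : ℝ} (hL0 : 0 ≤ L)
    (hL : ∀ i, U i ⬝ᵥ U i ≤ L) (e : ι → ℝ) :
    P.real {ω | ∃ s : Finset ι, S ω = s ∧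
        7 / 8 * p ^ 2 * ∑ i, e i ^ 2 < gradientNoise U e p s ⬝ᵥ gradientNoise U e p s}
      ≤ 8 * L / (7 * p) := by
  -- Markov's inequality divides by the threshold, which vanishes when e = 0; the strict inequality
  -- makes that event empty.
  rcases (Finset.sum_nonneg fun i (_ : i ∈ Finset.univ) => sq_nonneg (e i)).eq_or_lt with he | he
  · have hz : e = 0 := by
      funext i
      have := (Finset.sum_eq_zero_iff_of_nonneg fun i _ => sq_nonneg (e i)).1 he.symm i
        (Finset.mem_univ i)
      simpa using this
    have : {ω | ∃ s : Finset ι, S ω = s ∧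
        7 / 8 * p ^ 2 * ∑ i, e i ^ 2 < gradientNoise U e p s ⬝ᵥ gradientNoise U e p s} = ∅ := by
      refine Set.eq_empty_of_forall_notMem ?_
      rintro ω ⟨s, -, hs⟩
      have hg : gradientNoise U e p s = 0 := by
        rw [gradientNoise, hz]
        convert mulVec_zero Uᵀ
        simp
      rw [hg, ← he] at hs
      simp at hs
    rw [this, measureReal_empty]
    positivity
  · set τ := 7 / 8 * p ^ 2 * ∑ i, e i ^ 2 with hτ
    have hτ0 : 0 < τ := by positivity
    have hM := (hS.mul_measureReal_le h0.le h1
      (f := fun s => gradientNoise U e p s ⬝ᵥ gradientNoise U e p s)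
      (fun s => Finset.sum_nonneg fun _ _ => mul_self_nonneg _) hτ0.le).trans
      (bernoulliMean_gradientNoise_le hL e h0.le)
    have hsub : {ω | ∃ s : Finset ι, S ω = s ∧
        τ < gradientNoise U e p s ⬝ᵥ gradientNoise U e p s} ⊆ {ω | ∀ s : Finset ι, S ω = s →
        τ ≤ gradientNoise U e p s ⬝ᵥ gradientNoise U e p s} := by
      rintro ω ⟨s, hs, h⟩ s' hs'
      rw [← Finset.coe_injective (hs.symm.trans hs')]
      exact h.le
    have := (mul_le_mul_of_nonneg_left (measureReal_mono hsub (measure_ne_top P _))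
      hτ0.le).trans hM
    refine le_of_mul_le_mul_left (this.trans (le_of_eq ?_)) hτ0
    rw [hτ]
    field_simp

variable [DecidableEq κ]

theorem dotProduct_mulVec_self {U : Matrix ι κ ℝ} (hU : Uᵀ * U = 1) (z : κ → ℝ) :
    ∑ i, (U *ᵥ z) i ^ 2 = z ⬝ᵥ z := by
  rw [← dotProduct_rowGram_mulVec, rowGram_univ, hU, one_mulVec]

theorem transpose_mulVec_residual {U : Matrix ι κ ℝ} (hU : Uᵀ * U = 1) (T : ι → ℝ) :
    Uᵀ *ᵥ (T - U *ᵥ (Uᵀ *ᵥ T)) = 0 := by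
  rw [mulVec_sub, mulVec_mulVec, hU, one_mulVec, sub_self]

/-- Pythagoras: the residual of the full solution is orthogonal to the range of U. -/
theorem residualSumSq_univ {U : Matrix ι κ ℝ} (hU : Uᵀ * U = 1) (T : ι → ℝ) (y : κ → ℝ) :
    residualSumSq U T Finset.univ y = (y - Uᵀ *ᵥ T) ⬝ᵥ (y - Uᵀ *ᵥ T)
      + ∑ i, (T - U *ᵥ (Uᵀ *ᵥ T)) i ^ 2 := by
  set z := y - Uᵀ *ᵥ T with hz
  set e := T - U *ᵥ (Uᵀ *ᵥ T) with he
  have h := sum_mulVec_mul U z e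
  rw [transpose_mulVec_residual hU, dotProduct_zero] at h
  have h2 : ∀ i, (U *ᵥ y) i - T i = (U *ᵥ z) i - e i := fun i => by
    simp only [hz, he, mulVec_sub, Pi.sub_apply]; ring
  simp only [residualSumSq, h2, sub_sq, Finset.sum_add_distrib, Finset.sum_sub_distrib, mul_assoc,
    ← Finset.mul_sum, h, dotProduct_mulVec_self hU]
  ring

variable [DecidableEq ι]

theorem residualSumSq_le_of_isMin {U : Matrix ι κ ℝ} (hU : Uᵀ * U = 1) (T : ι → ℝ)
    {s : Finset ι} {p : ℝ} (hp : 0 < p)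
    (hG : ∀ v, v ⬝ᵥ v = 1 → p / 2 < v ⬝ᵥ rowGram U s *ᵥ v)
    (hb : gradientNoise U (T - U *ᵥ (Uᵀ *ᵥ T)) p s ⬝ᵥ gradientNoise U (T - U *ᵥ (Uᵀ *ᵥ T)) p s
      ≤ 7 / 8 * p ^ 2 * ∑ i, (T - U *ᵥ (Uᵀ *ᵥ T)) i ^ 2)
    {y : κ → ℝ} (hy : ∀ x, residualSumSq U T s y ≤ residualSumSq U T s x) (x : κ → ℝ) :
    residualSumSq U T Finset.univ y ≤ 9 / 2 * residualSumSq U T Finset.univ x := by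
  rw [residualSumSq_univ hU, residualSumSq_univ hU]
  have hx : 0 ≤ (x - Uᵀ *ᵥ T) ⬝ᵥ (x - Uᵀ *ᵥ T) := Finset.sum_nonneg fun _ _ => mul_self_nonneg _
  set z := y - Uᵀ *ᵥ T with hz
  set e := T - U *ᵥ (Uᵀ *ᵥ T) with he
  set b := gradientNoise U e p s with hbd
  have hzz : 0 ≤ z ⬝ᵥ z := Finset.sum_nonneg fun _ _ => mul_self_nonneg _
  set a := ∑ i ∈ s, (U *ᵥ z) i ^ 2 with ha
  set c := ∑ i ∈ s, (U *ᵥ z) i * e i with hc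
  -- The subtracted mean, p times the full inner product of Uz and e, is zero by orthogonality.
  have hcb : c = z ⬝ᵥ b := by
    rw [hbd, gradientNoise, ← sum_mulVec_mul]
    have h := sum_mulVec_mul U z e
    rw [transpose_mulVec_residual hU, dotProduct_zero] at h
    have : ∀ i, (U *ᵥ z) i * (((if i ∈ s then 1 else 0) - p) * e i)
        = (if i ∈ s then (U *ᵥ z) i * e i else 0) - p * ((U *ᵥ z) i * e i) := fun i => by
      split_ifs <;> ring
    simp only [this, Finset.sum_sub_distrib, ← Finset.mul_sum, h, Finset.sum_ite_mem,
      Finset.univ_inter, mul_zero, sub_zero, hc]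
  have hCS : (z ⬝ᵥ b) ^ 2 ≤ (z ⬝ᵥ z) * (b ⬝ᵥ b) := by
    simpa only [dotProduct, sq] using Finset.sum_mul_sq_le_sq_mul_sq Finset.univ z b
  have hlow : p / 2 * (z ⬝ᵥ z) ≤ a := by
    rw [ha, ← dotProduct_rowGram_mulVec]
    rcases hzz.eq_or_lt with h0 | h0
    · rw [← h0, mul_zero]
      simpa using (posSemidef_rowGram U s).dotProduct_mulVec_nonneg z
    · have hr : 0 < √(z ⬝ᵥ z) := Real.sqrt_pos.2 h0
      have hr2 : √(z ⬝ᵥ z) * √(z ⬝ᵥ z) = z ⬝ᵥ z := Real.mul_self_sqrt hzz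
      have h := hG ((√(z ⬝ᵥ z))⁻¹ • z) (by
        rw [smul_dotProduct, dotProduct_smul, smul_eq_mul, smul_eq_mul, ← mul_assoc, ← mul_inv,
          hr2, inv_mul_cancel₀ h0.ne'])
      rw [mulVec_smul, smul_dotProduct, dotProduct_smul, smul_eq_mul, smul_eq_mul, ← mul_assoc,
        ← mul_inv, hr2, inv_mul_eq_div, lt_div_iff₀ h0] at h
      exact h.le
  -- The half of the normal equations that is needed, by comparing y with y - tz. The optimal t is
  -- (a - c)/a; if a = 0, then t = 1 already contradicts minimality.
  have hnormal : a ≤ c := by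
    by_contra! hlt
    have ha0 : 0 ≤ a := Finset.sum_nonneg fun _ _ => sq_nonneg _
    have hquad : ∀ t : ℝ, 0 ≤ t ^ 2 * a - 2 * t * (a - c) := fun t => by
      have h := hy (y - t • z)
      have h1 : ∀ i, (U *ᵥ y) i - T i = (U *ᵥ z) i - e i := fun i => by
        simp only [hz, he, mulVec_sub, Pi.sub_apply]; ring
      have h2 : ∀ i, (U *ᵥ (y - t • z)) i - T i = (U *ᵥ z) i - e i - t * (U *ᵥ z) i := fun i => by
        rw [← h1, mulVec_sub, mulVec_smul]
        simp only [Pi.sub_apply, Pi.smul_apply, smul_eq_mul]; ring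
      simp only [residualSumSq, h1, h2] at h
      have h3 : ∑ i ∈ s, ((U *ᵥ z) i - e i - t * (U *ᵥ z) i) ^ 2
          = ∑ i ∈ s, ((U *ᵥ z) i - e i) ^ 2 + (t ^ 2 * a - 2 * t * (a - c)) := by
        simp only [ha, hc, ← Finset.sum_sub_distrib, Finset.mul_sum, ← Finset.sum_add_distrib]
        exact Finset.sum_congr rfl fun i _ => by ring
      linarith
    have hac : 0 < a - c := sub_pos.2 hlt
    rcases ha0.eq_or_lt with h0 | h0
    · have := hquad 1
      rw [← h0] at this hac
      linarith
    · have := hquad ((a - c) / a)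
      have e1 : ((a - c) / a) ^ 2 * a - 2 * ((a - c) / a) * (a - c) = -((a - c) ^ 2 / a) := by
        field_simp; ring
      have : 0 < (a - c) ^ 2 / a := by positivity
      linarith
  have hfin : z ⬝ᵥ z ≤ 7 / 2 * ∑ i, e i ^ 2 := by
    rcases hzz.eq_or_lt with h0 | h0
    · rw [← h0]
      have : 0 ≤ ∑ i, e i ^ 2 := Finset.sum_nonneg fun _ _ => sq_nonneg _
      positivity
    · have h1 : p / 2 * (z ⬝ᵥ z) ≤ z ⬝ᵥ b := hlow.trans (hnormal.trans hcb.le)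
      have h2 : (p / 2 * (z ⬝ᵥ z)) ^ 2 ≤ (z ⬝ᵥ z) * (b ⬝ᵥ b) :=
        (pow_le_pow_left₀ (by positivity) h1 2).trans hCS
      have h3 : p ^ 2 / 4 * (z ⬝ᵥ z) ≤ b ⬝ᵥ b :=
        le_of_mul_le_mul_left (by linarith) h0
      have h4 : p ^ 2 * (z ⬝ᵥ z) ≤ p ^ 2 * (7 / 2 * ∑ i, e i ^ 2) := by linarith
      exact le_of_mul_le_mul_left h4 (by positivity)
  linarith

/-- The range p ≤ 1/2 forces L ≤ 3/400, hence D ≥ 400/3 and log(2D) ≥ 4. Then p/L ≥ 120 makes the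
noise term at most 1/105, and the Chernoff term is at most exp(-8)/2. -/
theorem sum_tail_le {R D L p : ℝ} (hR : 1 ≤ R) (hRD : R ≤ D * L) (hD : 0 ≤ D) (hL : 0 < L)
    (hp : 40 / 3 * (Real.log (2 * D) + 5) * L ≤ p) (hp2 : p ≤ 1 / 2) (h2D : 0 ≤ Real.log (2 * D)) :
    R * Real.exp (-(p / (8 * L))) + 8 * L / (7 * p) ≤ 0.01 := by
  have hD0 : 0 < D := by
    rcases hD.eq_or_lt with h | h
    · rw [← h] at hRD; linarith
    · exact h
  have hL1 : L ≤ 3 / 400 := by nlinarith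
  have hD1 : 400 / 3 ≤ D := by nlinarith
  have hlog : 4 ≤ Real.log (2 * D) := by
    rw [Real.le_log_iff_exp_le (by positivity)]
    have h1 : Real.exp 4 = Real.exp 1 ^ 4 := by rw [← Real.exp_nat_mul]; norm_num
    have h2 : Real.exp 1 ^ 4 ≤ 3 ^ 4 :=
      pow_le_pow_left₀ (Real.exp_pos 1).le (by linarith [Real.exp_one_lt_d9]) 4
    rw [h1]
    linarith
  have hpL : 40 / 3 * (Real.log (2 * D) + 5) ≤ p / L := (le_div_iff₀ hL).2 hp
  have hp0 : 0 < p := by nlinarith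
  have e1 : 8 * L / (7 * p) ≤ 1 / 105 := by
    rw [div_le_div_iff₀ (by positivity) (by norm_num)]
    have : 120 * L ≤ p := by nlinarith
    linarith
  have e2 : R * Real.exp (-(p / (8 * L))) ≤ 1 / 2 * Real.exp (-8) := by
    have h1 : -(p / (8 * L)) ≤ -Real.log (2 * D) + -8 := by
      have : p / (8 * L) = p / L / 8 := by field_simp
      rw [this]; linarith
    have h2 := Real.exp_le_exp.2 h1
    rw [Real.exp_add, Real.exp_neg (Real.log _), Real.exp_log (by positivity)] at h2
    have h3 : R ≤ D := by nlinarith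
    calc _ ≤ D * ((2 * D)⁻¹ * Real.exp (-8)) :=
          mul_le_mul h3 h2 (Real.exp_pos _).le hD
      _ = _ := by field_simp
  have e3 : Real.exp (-8) ≤ 1 / 2500 := by
    have h1 : Real.exp 8 = Real.exp 1 ^ 8 := by rw [← Real.exp_nat_mul]; norm_num
    have h2 : (2.7 : ℝ) ^ 8 ≤ Real.exp 1 ^ 8 :=
      pow_le_pow_left₀ (by norm_num) (by linarith [Real.exp_one_gt_d9]) 8
    rw [Real.exp_neg, inv_eq_one_div, h1]
    exact one_div_le_one_div_of_le (by norm_num) (le_trans (by norm_num) h2)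
  norm_num at *
  linarith

/-- Sampled least squares is nearly optimal for an incoherent orthonormal design. -/
theorem IsBernoulliSample.residualSumSq_le {Ω : Type*} [MeasurableSpace Ω] {P : Measure Ω}
    [IsProbabilityMeasure P] {S : Ω → Set ι} {p : ℝ} (hS : IsBernoulliSample P S p)
    [Nonempty κ] {U : Matrix ι κ ℝ} (hU : Uᵀ * U = 1) {L : ℝ} (hL : ∀ i, U i ⬝ᵥ U i ≤ L)
    (hp : 40 / 3 * (Real.log (2 * Fintype.card ι) + 5) * L ≤ p) (hp2 : p ≤ 1 / 2) (T : ι → ℝ) :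
    0.99 ≤ P.real {ω | ∀ s : Finset ι, S ω = s → ∀ y,
      (∀ x, residualSumSq U T s y ≤ residualSumSq U T s x) → ∀ x,
      residualSumSq U T Finset.univ y ≤ 9 / 2 * residualSumSq U T Finset.univ x} := by
  have hR : (1 : ℝ) ≤ Fintype.card κ := by exact_mod_cast Fintype.card_pos
  -- The squared row norms sum to the trace of the identity on the columns.
  have hRD : (Fintype.card κ : ℝ) ≤ Fintype.card ι * L := by
    have h := sum_dotProduct_mulVec_row hU 1
    simp only [one_mulVec, trace_one] at h
    rw [← h, ← nsmul_eq_mul]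
    exact Finset.sum_le_card_nsmul _ _ _ fun i _ => hL i
  have hDpos : 0 < Fintype.card ι := by
    rcases Nat.eq_zero_or_pos (Fintype.card ι) with h | h
    · rw [h] at hRD; norm_num at hRD
    · exact h
  have hD1 : (1 : ℝ) ≤ Fintype.card ι := by exact_mod_cast hDpos
  have hL0 : 0 < L := by
    by_contra! h
    nlinarith
  have hlog : 0 ≤ Real.log (2 * (Fintype.card ι : ℝ)) := Real.log_nonneg (by linarith)
  have hp0 : 0 < p := lt_of_lt_of_le (by positivity) hp
  have hp1 : p ≤ 1 := by linarith
  have b1 := hS.lowerTail hp0.le hp1 hU hL0 hL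
  have b2 := hS.gradientNoise_tail hp0 hp1 hL0.le hL (T - U *ᵥ (Uᵀ *ᵥ T))
  have b3 := sum_tail_le hR hRD (by positivity) hL0 hp hp2 hlog
  set B1 := {ω | ∃ v : κ → ℝ, v ⬝ᵥ v = 1 ∧ ∀ s : Finset ι, S ω = s →
        v ⬝ᵥ rowGram U s *ᵥ v ≤ p / 2}
  set e := T - U *ᵥ (Uᵀ *ᵥ T) with he
  set B2 := {ω | ∃ s : Finset ι, S ω = s ∧
        7 / 8 * p ^ 2 * ∑ i, e i ^ 2 < gradientNoise U e p s ⬝ᵥ gradientNoise U e p s}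
  set E := {ω | ∀ s : Finset ι, S ω = s → ∀ y,
      (∀ x, residualSumSq U T s y ≤ residualSumSq U T s x) → ∀ x,
      residualSumSq U T Finset.univ y ≤ 9 / 2 * residualSumSq U T Finset.univ x}
  -- Covering the whole space bounds the probability of E from below by subadditivity alone, without
  -- measurability of E.
  have hcover : Set.univ ⊆ E ∪ (B1 ∪ B2) := by
    intro ω _
    by_cases h1 : ω ∈ B1
    · exact Or.inr (Or.inl h1)
    by_cases h2 : ω ∈ B2
    · exact Or.inr (Or.inr h2)
    refine Or.inl fun s hs y hy x => residualSumSq_le_of_isMin hU T hp0 (fun v hv => ?_) ?_ hy x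
    · by_contra! h
      refine h1 ⟨v, hv, fun s' hs' => ?_⟩
      rwa [← Finset.coe_injective (hs.symm.trans hs')]
    · by_contra! h
      exact h2 ⟨s, hs, h⟩
  have h1 := measureReal_mono hcover (measure_ne_top P _)
  rw [probReal_univ] at h1
  have h2 := measureReal_union_le (μ := P) E (B1 ∪ B2)
  have h3 := measureReal_union_le (μ := P) B1 B2
  norm_num at b3 ⊢
  linarith

end LeastSquares

/-! ### From Tucker products to a Kronecker design matrix -/

section Tucker
open Matrix
variable {N : ℕ} {I r : Fin N → ℕ}

/-- The Kronecker product of a family of matrices. -/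
def kroneckerPi (A : ∀ n, Matrix (Fin (I n)) (Fin (r n)) ℝ) :
    Matrix (∀ n, Fin (I n)) (∀ n, Fin (r n)) ℝ :=
  Matrix.of fun i j => ∏ n, A n (i n) (j n)

theorem kroneckerPi_transpose_mul_self {A : ∀ n, Matrix (Fin (I n)) (Fin (r n)) ℝ}
    (hA : ∀ n, (A n)ᵀ * A n = 1) : (kroneckerPi A)ᵀ * kroneckerPi A = 1 := by
  ext j k
  simp only [mul_apply, transpose_apply, kroneckerPi, of_apply, ← Finset.prod_mul_distrib]
  have h : ∀ n, ∑ x, A n x (j n) * A n x (k n) = if j n = k n then 1 else 0 := fun n => by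
    have := congrFun (congrFun (hA n) (j n)) (k n)
    simpa [mul_apply, one_apply] using this
  have h2 := Finset.prod_univ_sum (fun n => (Finset.univ : Finset (Fin (I n))))
    (fun n x => A n x (j n) * A n x (k n))
  rw [Fintype.piFinset_univ] at h2
  rw [← h2]
  simp only [h, one_apply, funext_iff]
  by_cases hjk : ∀ n, j n = k n
  · simp [hjk]
  · rw [if_neg hjk]
    push Not at hjk
    obtain ⟨n, hn⟩ := hjk
    exact Finset.prod_eq_zero (Finset.mem_univ n) (if_neg hn)

theorem kroneckerPi_row_dotProduct (A : ∀ n, Matrix (Fin (I n)) (Fin (r n)) ℝ)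
    (i : ∀ n, Fin (I n)) :
    kroneckerPi A i ⬝ᵥ kroneckerPi A i = ∏ n, ∑ j, A n (i n) j ^ 2 := by
  simp only [dotProduct, kroneckerPi, of_apply, ← sq]
  rw [Finset.prod_univ_sum, Fintype.piFinset_univ]
  simp only [Finset.prod_pow]

/-- For a row b with x = ‖b‖², the vector Bb has squared norm x and an entry equal to x, so x² ≤ x.
-/
theorem sum_sq_row_le_one {m k : ℕ} {B : Matrix (Fin m) (Fin k) ℝ} (hB : Bᵀ * B = 1) (i : Fin m) :
    ∑ j, B i j ^ 2 ≤ 1 := by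
  set x := ∑ j, B i j ^ 2 with hx
  have h := dotProduct_mulVec_self hB (B i)
  have h1 : B i ⬝ᵥ B i = x := by simp [dotProduct, hx, sq]
  have h2 : (B *ᵥ B i) i = x := h1
  have h3 := Finset.single_le_sum (f := fun l => (B *ᵥ B i) l ^ 2) (fun _ _ => sq_nonneg _)
    (Finset.mem_univ i)
  simp only [h, h1, h2] at h3
  nlinarith

theorem sum_sq_row_le {m k : ℕ} {B : Matrix (Fin m) (Fin k) ℝ} (hB : Bᵀ * B = 1) (hk : 0 < k)
    {c : ℝ} (hc : twoInfNorm B ≤ √c) (i : Fin m) : ∑ j, B i j ^ 2 ≤ c := by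
  have hle : ∀ i, √(∑ j, B i j ^ 2) ≤ √c := fun i =>
    (le_ciSup (f := fun i => √(∑ j, B i j ^ 2)) (Set.finite_range _).bddAbove i).trans hc
  by_cases hc0 : 0 ≤ c
  · exact (Real.sqrt_le_sqrt_iff hc0).1 (hle i)
  -- For negative c, `√c` is 0, so B would vanish, which is impossible with orthonormal columns when
  -- k > 0.
  · exfalso
    have hz : ∀ i j, B i j = 0 := fun i j => by
      have h := hle i
      rw [Real.sqrt_eq_zero_of_nonpos (not_le.1 hc0).le] at h
      have h2 := Real.sqrt_eq_zero'.1 (le_antisymm h (Real.sqrt_nonneg _))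
      have h3 := Finset.single_le_sum (f := fun j => B i j ^ 2) (fun _ _ => sq_nonneg _)
        (Finset.mem_univ j)
      exact pow_eq_zero_iff two_ne_zero |>.1 (le_antisymm (h3.trans h2) (sq_nonneg _))
    have := congrFun (congrFun hB ⟨0, hk⟩) ⟨0, hk⟩
    simp [mul_apply, hz] at this

theorem kroneckerPi_row_le (hN : 1 ≤ N) {A : ∀ n, Matrix (Fin (I n)) (Fin (r n)) ℝ}
    (hA : ∀ n, (A n)ᵀ * A n = 1) (hr : ∀ n, 0 < r n) {c : Fin N → ℝ}
    (hc : ∀ n, twoInfNorm (A n) ≤ √(c n)) (i : ∀ n, Fin (I n)) :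
    kroneckerPi A i ⬝ᵥ kroneckerPi A i ≤ ⨆ n, ∏ k ∈ Finset.univ.erase n, c k := by
  -- Any mode could be the one bounded by 1; the supremum dominates the product over the others.
  let n₀ : Fin N := ⟨0, hN⟩
  have h0 : ∀ n, 0 ≤ ∑ j, A n (i n) j ^ 2 := fun n => Finset.sum_nonneg fun _ _ => sq_nonneg _
  refine le_trans ?_ (le_ciSup (f := fun n => ∏ k ∈ Finset.univ.erase n, c k)
    (Set.finite_range _).bddAbove n₀)
  rw [kroneckerPi_row_dotProduct, ← Finset.prod_erase_mul _ _ (Finset.mem_univ n₀)]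
  refine (mul_le_of_le_one_right (Finset.prod_nonneg fun n _ => h0 n)
    (sum_sq_row_le_one (hA n₀) _)).trans ?_
  exact Finset.prod_le_prod (fun n _ => h0 n) fun n _ => sum_sq_row_le (hA n) (hr n) (hc n) _

theorem fullResidual_eq (A : ∀ n, Matrix (Fin (I n)) (Fin (r n)) ℝ) (T : RTensor I)
    (X : RTensor r) :
    fullResidual A T X = √(residualSumSq (kroneckerPi A) T Finset.univ X) := rfl

theorem obsResidual_eq (s : Finset (∀ n, Fin (I n))) (A : ∀ n, Matrix (Fin (I n)) (Fin (r n)) ℝ)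
    (T : RTensor I) (X : RTensor r) :
    obsResidual (s : Set (∀ n, Fin (I n))) A T X
      = √(residualSumSq (kroneckerPi A) T s X) := by
  classical
  rw [obsResidual, frobNorm, residualSumSq]
  congr 1
  rw [← Finset.sum_subset (Finset.subset_univ s)]
  · exact Finset.sum_congr rfl fun i hi => by
      rw [obsProj, Set.indicator_of_mem (Finset.mem_coe.2 hi)]; rfl
  · intro i _ hi
    rw [obsProj, Set.indicator_of_notMem (by simpa using hi)]; simp

theorem residualSumSq_nonneg {ι κ : Type*} [Fintype κ] (U : Matrix ι κ ℝ) (T : ι → ℝ)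
    (s : Finset ι) (x : κ → ℝ) : 0 ≤ residualSumSq U T s x :=
  Finset.sum_nonneg fun _ _ => sq_nonneg _

end Tucker

/-! ### The main theorem -/

theorem lemma4p2 {Ω : Type*} [MeasurableSpace Ω] (P : Measure Ω) [IsProbabilityMeasure P]
    {N : ℕ} (hN : 1 ≤ N) (I r : Fin N → ℕ) (T : RTensor I)
    (A : ∀ n, Matrix (Fin (I n)) (Fin (r n)) ℝ)
    (hA : ∀ n, (A n).transpose * A n = 1)
    (μ : Fin N → ℝ)
    (hinc : ∀ n, twoInfNorm (A n) ≤ √(μ n * (r n : ℝ) / (I n : ℝ)))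
    (p : ℝ) (hp : p ∈ Set.Icc (4 * pStar I r μ) (1 / 2))
    (S : Ω → Set (∀ n, Fin (I n))) (hS : IsBernoulliSample P S p) :
    (∃ X, IsMinOn (fullResidual A T) Set.univ X) ∧
    (∀ ω, ∃ Y, IsMinOn (obsResidual (S ω) A T) Set.univ Y) ∧
    0.99 ≤ P.real {ω | ∀ X Y : RTensor r,
      IsMinOn (fullResidual A T) Set.univ X →
      IsMinOn (obsResidual (S ω) A T) Set.univ Y →
      fullResidual A T X ≤ fullResidual A T Y ∧
        fullResidual A T Y ≤ 3 / √2 * fullResidual A T X} := by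
  classical
  refine ⟨?_, fun ω => ?_, ?_⟩
  · obtain ⟨X, hX⟩ := exists_residualSumSq_le (kroneckerPi A) T Finset.univ
    exact ⟨X, fun Y _ => Real.sqrt_le_sqrt (hX Y)⟩
  · obtain ⟨Y, hY⟩ := exists_residualSumSq_le (kroneckerPi A) T (S ω).toFinset
    refine ⟨Y, fun X _ => ?_⟩
    have h := fun Z => obsResidual_eq (S ω).toFinset A T Z
    rw [Set.coe_toFinset] at h
    rw [Set.mem_ofPred_eq, h, h]
    exact Real.sqrt_le_sqrt (hY X)
  · have h92 : (1 : ℝ) ≤ 3 / √2 := by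
      rw [one_le_div (by positivity), Real.sqrt_le_left (by norm_num)]
      norm_num
    have hsq : √(9 / 2) = 3 / √2 := by
      rw [Real.sqrt_div (by norm_num), show (9 : ℝ) = 3 ^ 2 by norm_num,
        Real.sqrt_sq (by norm_num)]
    by_cases hr : ∀ n, 0 < r n
    · have : Nonempty (∀ n, Fin (r n)) := ⟨fun n => ⟨0, hr n⟩⟩
      have hL := kroneckerPi_row_le hN hA hr hinc
      have hcard : (Fintype.card (∀ n, Fin (I n)) : ℝ) = ∏ k, (I k : ℝ) := by
        simp [Fintype.card_pi]
      have h := hS.residualSumSq_le (kroneckerPi_transpose_mul_self hA) hL (by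
        rw [hcard]
        refine le_trans (le_of_eq ?_) hp.1
        rw [pStar]
        ring) hp.2 T
      refine h.trans (measureReal_mono (fun ω hω X Y hX hY => ⟨hX (Set.mem_univ Y), ?_⟩)
        (measure_ne_top P _))
      have hω' := hω (S ω).toFinset (Set.coe_toFinset _).symm Y (fun Z => by
        have h := fun Z => obsResidual_eq (S ω).toFinset A T Z
        rw [Set.coe_toFinset] at h
        have hZ := hY (Set.mem_univ Z)
        rw [Set.mem_ofPred_eq, h, h] at hZ
        exact (Real.sqrt_le_sqrt_iff (residualSumSq_nonneg _ _ _ _)).1 hZ) X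
      rw [fullResidual_eq, fullResidual_eq, ← hsq, ← Real.sqrt_mul (by norm_num)]
      exact Real.sqrt_le_sqrt hω'
    -- If some r n is 0, there is only one core tensor, so the two minimizers coincide.
    · push Not at hr
      obtain ⟨n, hn⟩ := hr
      have : IsEmpty (∀ n, Fin (r n)) :=
        ⟨fun j => absurd (j n).isLt (by omega)⟩
      have huniv : {ω | ∀ X Y : RTensor r, IsMinOn (fullResidual A T) Set.univ X →
          IsMinOn (obsResidual (S ω) A T) Set.univ Y →
          fullResidual A T X ≤ fullResidual A T Y ∧
            fullResidual A T Y ≤ 3 / √2 * fullResidual A T X} = Set.univ := by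
        refine Set.eq_univ_of_forall fun ω X Y _ _ => ?_
        rw [Subsingleton.elim Y X]
        exact ⟨le_rfl, le_mul_of_one_le_left (Real.sqrt_nonneg _) h92⟩
      rw [huniv, probReal_univ]
      norm_num
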